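/- Let $\kappa$ be an infinite cardinal and let $S$ be a non-empty set with $|S|<\kappa$. A (single-sorted) $<\kappa$-ary clone $C$ consists of sets $C_\lambda$ for all cardinals $\lambda<\kappa$, projections $\pi_{(\lambda,i)}\in C_\lambda$ ($i\in\lambda$) and compositions $C_{\lambda}\times (C_{\mu})^{\lambda}\to C_{\mu}$, $(f,(g_i)_{i\in\lambda})\mapsto f\circ(g_i)_{i\in\lambda}$, such that $$f\circ(g_i\circ(h_j)_j)_i=(f\circ(g_i)_i)\circ(h_j)_j,\qquad \pi_{(\lambda,i)}\circ(g_j)_j=g_i,\qquad f\circ(\pi_{(\lambda,i)})_i=f .$$ For a set $X$ with $|X|<\kappa$ we write $C_X$ and $\pi_{(X,x)}$ for $C_{|X|}$ and the corresponding projection, via a fixed bijection $X\to|X|$. A $C$-algebra is a (possibly empty) set $A$ on which every $f\in C_\lambda$ acts as a map $A^\lambda\to A$, so that projections act as projections and composition of elements acts as composition of maps. $\mathcal V(C)$ denotes the class of all $C$-algebras. A congruence of $A$ is an equivalence relation on $A$ that is a subalgebra of $A^2$; $A$ is congruence permutable if $\theta\circ\eta=\eta\circ\theta$ for all congruences $\theta,\eta$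 of $A$, and a class of algebras is congruence permutable if all its members are. An $S$-ary diagonal pair of $C$ is a tuple $(d,(e_s)_{s\in S})\in C_S\times C_1^{\,S}$ such that 1. $e_s\circ d=e_s\circ\pi_{(S,s)}$ for all $s\in S$; 2. $d\circ(e_s\circ\pi_{(S,s)})_{s\in S}=d$; 3. $d\circ(\pi_{(S,s_0)})_{s\in S}=\pi_{(S,s_0)}$ for all $s_0\in S$. Every $e_s$ is then idempotent, $e_s\circ e_s=e_s$. For an idempotent $e\in C_1$, the idempotent retract $e(C)$ is the $<\kappa$-ary clone with $$e(C)_\lambda=\{f\in C_\lambda\mid e\circ f=f\}/\!\sim_\lambda,\qquad f\sim_\lambda g\iff f\circ(e\circ\pi_{(\lambda,i)})_{i\in\lambda}=g\circ(e\circ\pi_{(\lambda,i)})_{i\in\lambda},$$ with projections $(e\circ\pi_{(\lambda,i)})/\!\sim_\lambda$ and composition $(f/\!\sim_\lambda)\circ(g_i/\!\sim_\mu)_{i\in\lambda}=(f\circ(g_i)_{i\in\lambda})/\!\sim_\mu$. **Theorem.** Let $C$ be a single-sorted $<\kappa$-ary clone and let $(d,(e_s)_{s\in S})$ be an $S$-ary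 diagonal pair of $C$. Then the following are equivalent: 1. the variety $\mathcal V(C)$ is congruence permutable; 2. for every $s\in S$, the variety $\mathcal V(e_s(C))$ is congruence permutable. -/

import Mathlib

open Cardinal

universe u

/-- The cardinals `< κ`: the sorts (arities) of a single-sorted `<κ`-ary clone. -/
abbrev CloneArity (κ : Cardinal.{u}) : Type (u + 1) := {l : Cardinal.{u} // l < κ}

/-- A chosen set with `l` elements, indexing the arguments of an `l`-ary operation. -/
abbrev CloneArity.Idx {κ : Cardinal.{u}} (l : CloneArity κ) : Type u := l.1.out

/-- A single-sorted `<κ`-ary (abstract) clone: the sets `Op l` of `l`-ary elements for cardinals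
`l < κ`, with projections and compositions satisfying associativity and the outer and inner
identity laws. -/
structure SingleSortedClone (κ : Cardinal.{u}) : Type (u + 1) where
  Op : CloneArity κ → Type u
  proj : (l : CloneArity κ) → l.Idx → Op l
  comp : {l m : CloneArity κ} → Op l → (l.Idx → Op m) → Op m
  assoc : ∀ {l m n : CloneArity κ} (x : Op l) (y : l.Idx → Op m) (z : m.Idx → Op n),
    comp x (fun i => comp (y i) z) = comp (comp x y) z
  outer_id : ∀ {l m : CloneArity κ} (i : l.Idx) (x : l.Idx → Op m), comp (proj l i) x = x i
  inner_id : ∀ {l : CloneArity κ} (x : Op l), comp x (proj l) = x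

namespace SingleSortedClone

variable {κ : Cardinal.{u}}

/-- An algebra of the clone `C`: each `f ∈ C_l` acts as an `l`-ary operation on the carrier (which
may be empty), compatibly with composition, and projections act as projections. -/
structure Algebra (C : SingleSortedClone κ) : Type (u + 1) where
  carrier : Type u
  act : {l : CloneArity κ} → C.Op l → (l.Idx → carrier) → carrier
  act_proj : ∀ {l : CloneArity κ} (i : l.Idx) (a : l.Idx → carrier), act (C.proj l i) a = a i
  act_comp : ∀ {l m : CloneArity κ} (f : C.Op l) (g : l.Idx → C.Op m) (a : m.Idx → carrier),
    act (C.comp f g) a = act f (fun i => act (g i) a)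

/-- The class `V(C)` of all `C`-algebras. -/
def variety (C : SingleSortedClone κ) : Set C.Algebra := Set.univ

/-- A congruence of `A`: an equivalence relation on the carrier that is a subalgebra of `A²`. -/
structure Algebra.Con {C : SingleSortedClone κ} (A : C.Algebra) extends Setoid A.carrier where
  act_rel : ∀ {l : CloneArity κ} (f : C.Op l) (a b : l.Idx → A.carrier),
    (∀ i, r (a i) (b i)) → r (A.act f a) (A.act f b)

/-- `A` is congruence permutable: `θ ∘ η = η ∘ θ` for all congruences `θ`, `η` of `A`. -/
def Algebra.CongruencePermutable {C : SingleSortedClone κ} (A : C.Algebra) : Prop :=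
  ∀ θ η : A.Con, Relation.Comp θ.r η.r = Relation.Comp η.r θ.r

/-- A class of algebras is congruence permutable if all its members are. -/
def CongruencePermutable {C : SingleSortedClone κ} (K : Set C.Algebra) : Prop :=
  ∀ A ∈ K, A.CongruencePermutable

/-- The arity `1`. -/
def one (hκ : ℵ₀ ≤ κ) : CloneArity κ := ⟨1, one_lt_aleph0.trans_le hκ⟩

/-- The arity given by a set `S` with fewer than `κ` elements. -/
def ofSet (S : Type u) (hS : #S < κ) : CloneArity κ := ⟨#S, hS⟩

/-- The chosen bijection between the index set of the arity `#S` and `S`. -/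
noncomputable def idx {S : Type u} {hS : #S < κ} : (ofSet S hS).Idx ≃ S := outMkEquiv

variable (C : SingleSortedClone κ)

/-- The `S`-ary projection `π_{(S,s)}`. -/
noncomputable def projS {S : Type u} (hS : #S < κ) (s : S) : C.Op (ofSet S hS) :=
  C.proj (ofSet S hS) (idx.symm s)

variable {C}

/-- The composition `d ∘ (x_s)_{s ∈ S}` of an `S`-ary element `d` with an `S`-indexed family. -/
noncomputable def compS {S : Type u} {hS : #S < κ} {m : CloneArity κ} (d : C.Op (ofSet S hS))
    (x : S → C.Op m) : C.Op m :=
  C.comp d (fun i => x (idx i))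

/-- The composition `e ∘ f` of a unary element `e` with an `l`-ary element `f`. -/
def comp₁ {hκ : ℵ₀ ≤ κ} {m : CloneArity κ} (e : C.Op (one hκ)) (f : C.Op m) : C.Op m :=
  C.comp e (fun _ => f)

/-- `(d, (e_s)_{s ∈ S}) ∈ C_S × C_1^S` is an `S`-ary diagonal pair of the clone `C`. -/
structure IsDiagonalPair {hκ : ℵ₀ ≤ κ} {S : Type u} {hS : #S < κ} (d : C.Op (ofSet S hS))
    (e : S → C.Op (one hκ)) : Prop where
  e_d : ∀ s, comp₁ (e s) d = comp₁ (e s) (C.projS hS s)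
  d_e : compS d (fun s => comp₁ (e s) (C.projS hS s)) = d
  d_diag : ∀ s₀ : S, compS d (fun _ => C.projS hS s₀) = C.projS hS s₀

/-- `e ∈ C_1` is idempotent. -/
def IsIdempotent {hκ : ℵ₀ ≤ κ} (e : C.Op (one hκ)) : Prop := comp₁ e e = e

theorem comp₁_comp {hκ : ℵ₀ ≤ κ} {l m : CloneArity κ} (e : C.Op (one hκ)) (f : C.Op l)
    (g : l.Idx → C.Op m) : C.comp (comp₁ e f) g = comp₁ e (C.comp f g) :=
  (C.assoc e (fun _ => f) g).symm

theorem comp₁_comp₁ {hκ : ℵ₀ ≤ κ} {m : CloneArity κ} (e e' : C.Op (one hκ)) (f : C.Op m) :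
    comp₁ (comp₁ e e') f = comp₁ e (comp₁ e' f) :=
  comp₁_comp e e' _

theorem comp_projS {S : Type u} {hS : #S < κ} {m : CloneArity κ} (x : S → C.Op m) (s : S) :
    C.comp (C.projS hS s) (fun i => x (idx i)) = x s := by
  simp [projS, C.outer_id]

/-- The unary components of a diagonal pair are idempotent. -/
theorem IsDiagonalPair.idempotent {hκ : ℵ₀ ≤ κ} {S : Type u} {hS : #S < κ}
    {d : C.Op (ofSet S hS)} {e : S → C.Op (one hκ)} (h : IsDiagonalPair d e) (s : S) :
    IsIdempotent (e s) := by
  -- evaluate `e_s ∘ d ∘ (e_t ∘ x)_t` in two ways, with `x` the unary projection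
  have h0 : ∀ x : S → C.Op (one hκ), comp₁ (e s) (compS d x) = comp₁ (e s) (x s) := by
    intro x
    have := congrArg (fun f => C.comp f (fun i => x (idx i))) (h.e_d s)
    simpa only [compS, comp₁_comp, comp_projS] using this
  have h1 : ∀ x : S → C.Op (one hκ), compS d (fun t => comp₁ (e t) (x t)) = compS d x := by
    intro x
    have := congrArg (fun f => C.comp f (fun i => x (idx i))) h.d_e
    simpa only [compS, ← C.assoc, comp₁_comp, comp_projS] using this
  have he : ∀ i, comp₁ (e s) (C.proj (one hκ) i) = e s := by
    intro i
    have hsub : Subsingleton (one hκ : CloneArity κ).Idx := by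
      rw [← le_one_iff_subsingleton]
      exact (mk_out (1 : Cardinal.{u})).le
    have : (fun _ : (one hκ : CloneArity κ).Idx => C.proj (one hκ) i) = C.proj (one hκ) := by
      funext j
      rw [Subsingleton.elim i j]
    unfold comp₁
    rw [this, C.inner_id]
  obtain ⟨i⟩ : Nonempty (one hκ : CloneArity κ).Idx := by
    rw [← mk_ne_zero_iff]
    exact (mk_out (1 : Cardinal.{u})).trans_ne one_ne_zero
  have h2 := (h0 (fun t => comp₁ (e t) (C.proj (one hκ) i))).symm.trans
    ((congrArg (comp₁ (e s)) (h1 (fun _ => C.proj (one hκ) i))).trans (h0 _))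
  simpa only [IsIdempotent, he] using h2

/-! ### The idempotent retract `e(C)` -/

section Retract

variable {hκ : ℵ₀ ≤ κ} (e : C.Op (one hκ))

/-- The tuple `(e ∘ π_{(l,i)})_{i ∈ l}`. -/
def eproj (l : CloneArity κ) : l.Idx → C.Op l := fun i => comp₁ e (C.proj l i)

/-- The equivalence `f ∼ g ↔ f ∘ (e π_i)_i = g ∘ (e π_i)_i` on `{f ∈ C_l | e ∘ f = f}`. -/
def retractSetoid (l : CloneArity κ) : Setoid {f : C.Op l // comp₁ e f = f} where
  r f g := C.comp f.1 (eproj e l) = C.comp g.1 (eproj e l)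
  iseqv := ⟨fun _ => rfl, fun h => h.symm, fun h h' => h.trans h'⟩

/-- The underlying set `e(C)_l = {f ∈ C_l | e ∘ f = f} / ∼`. -/
def RetractOp (l : CloneArity κ) : Type u := Quotient (retractSetoid e l)

variable {e}

/-- The class of `f` in `e(C)_l`. -/
def RetractOp.mk {l : CloneArity κ} (f : C.Op l) (hf : comp₁ e f = f) : RetractOp e l :=
  Quotient.mk (retractSetoid e l) ⟨f, hf⟩

theorem RetractOp.sound {l : CloneArity κ} {f g : C.Op l} {hf : comp₁ e f = f}
    {hg : comp₁ e g = g} (h : C.comp f (eproj e l) = C.comp g (eproj e l)) :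
    RetractOp.mk f hf = RetractOp.mk g hg :=
  Quotient.sound (s := retractSetoid e l) h

theorem RetractOp.exact {l : CloneArity κ} {f g : C.Op l} {hf : comp₁ e f = f}
    {hg : comp₁ e g = g} (h : RetractOp.mk f hf = RetractOp.mk g hg) :
    C.comp f (eproj e l) = C.comp g (eproj e l) :=
  Quotient.exact (s := retractSetoid e l) h

/-- A representative of an element of `e(C)_l`. -/
noncomputable def RetractOp.rep {l : CloneArity κ} (F : RetractOp e l) : C.Op l :=
  (Quotient.out (s := retractSetoid e l) F).1

theorem RetractOp.e_rep {l : CloneArity κ} (F : RetractOp e l) : comp₁ e F.rep = F.rep :=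
  (Quotient.out (s := retractSetoid e l) F).2

theorem RetractOp.mk_rep {l : CloneArity κ} (F : RetractOp e l) :
    RetractOp.mk F.rep F.e_rep = F :=
  Quotient.out_eq (s := retractSetoid e l) F

theorem RetractOp.e_comp {l m : CloneArity κ} {f : C.Op l} (hf : comp₁ e f = f)
    (g : l.Idx → C.Op m) : comp₁ e (C.comp f g) = C.comp f g := by
  rw [← comp₁_comp, hf]

/-- Composition in `e(C)`; by `RetractOp.comp_mk`, `[f] ∘ ([g_i])_i = [f ∘ (g_i)_i]` for all
representatives. -/
noncomputable def RetractOp.comp {l m : CloneArity κ} (F : RetractOp e l)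
    (G : l.Idx → RetractOp e m) : RetractOp e m :=
  RetractOp.mk (C.comp F.rep (fun i => (G i).rep)) (RetractOp.e_comp F.e_rep _)

theorem RetractOp.comp_congr {l m : CloneArity κ} {f f' : C.Op l} {g g' : l.Idx → C.Op m}
    (hf : C.comp f (eproj e l) = C.comp f' (eproj e l)) (hg' : ∀ i, comp₁ e (g' i) = g' i)
    (hg : ∀ i, C.comp (g i) (eproj e m) = C.comp (g' i) (eproj e m)) :
    C.comp (C.comp f g) (eproj e m) = C.comp (C.comp f' g') (eproj e m) := by
  have key : ∀ x : C.Op l, C.comp x g' = C.comp (C.comp x (eproj e l)) g' := by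
    intro x
    rw [← C.assoc]
    congr 1
    funext i
    rw [eproj, comp₁_comp, C.outer_id, hg' i]
  rw [← C.assoc, funext hg, C.assoc, key f, hf, ← key f']

theorem RetractOp.comp_mk {l m : CloneArity κ} (f : C.Op l) (hf : comp₁ e f = f)
    (g : l.Idx → C.Op m) (hg : ∀ i, comp₁ e (g i) = g i) :
    RetractOp.comp (RetractOp.mk f hf) (fun i => RetractOp.mk (g i) (hg i)) =
      RetractOp.mk (C.comp f g) (RetractOp.e_comp hf g) :=
  RetractOp.sound (RetractOp.comp_congr (RetractOp.exact (RetractOp.mk_rep _)) hg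
    (fun _ => RetractOp.exact (RetractOp.mk_rep _)))

theorem RetractOp.e_eproj (he : IsIdempotent e) (l : CloneArity κ) (i : l.Idx) :
    comp₁ e (eproj e l i) = eproj e l i := by
  rw [eproj, ← comp₁_comp₁, show comp₁ e e = e from he]

variable (e)

/-- The idempotent retract `e(C)` of the clone `C` by an idempotent element `e ∈ C_1`. -/
noncomputable def retract (he : IsIdempotent e) : SingleSortedClone κ where
  Op := RetractOp e
  proj l i := RetractOp.mk (eproj e l i) (RetractOp.e_eproj he l i)
  comp F G := RetractOp.comp F G
  assoc {l m n} x y z := by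
    have hz : z = fun j => RetractOp.mk (z j).rep (z j).e_rep :=
      funext fun j => (z j).mk_rep.symm
    have hy : y = fun i => RetractOp.mk (y i).rep (y i).e_rep :=
      funext fun i => (y i).mk_rep.symm
    rw [← x.mk_rep, hy, hz]
    simp only [RetractOp.comp_mk]
    apply RetractOp.sound
    rw [C.assoc]
  outer_id {l m} i x := by
    have hx : x = fun j => RetractOp.mk (x j).rep (x j).e_rep :=
      funext fun j => (x j).mk_rep.symm
    rw [hx]
    simp only [RetractOp.comp_mk]
    apply RetractOp.sound
    rw [eproj, comp₁_comp, C.outer_id, (x i).e_rep]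
  inner_id {l} x := by
    rw [← x.mk_rep]
    simp only [RetractOp.comp_mk]
    apply RetractOp.sound
    rw [← C.assoc]
    congr 1
    funext i
    conv_lhs => rw [eproj, comp₁_comp, C.outer_id, RetractOp.e_eproj he]

end Retract

end SingleSortedClone

/-! Mal'cev's theorem turns congruence permutability into the existence of a ternary `p` with
`p(x,x,y) = y` and `p(x,y,y) = x` (`congruencePermutable_iff_exists_isMalcev`), and such elements
pass between `C` and its retracts. Downwards, the class of `e_s ∘ p` is Mal'cev in `e_s(C)`
(`IsMalcev.retract`). Upwards, a Mal'cev element of `e_s(C)` is represented by some `p_s` satisfying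
the identities on arguments of the form `e_s ∘ x` (`IsMalcev.of_retract`). The diagonal element
glues these into `q(x,y,z) = d(p_s(e_s x, e_s y, e_s z))_s`. Then `q(x,x,y) = d(e_s y)_s = d(y)_s =
y` by `d_e` and `d_diag`, and likewise `q(x,y,y) = x`. The axiom `e_d` enters through the
idempotency of `e_s`. -/

namespace SingleSortedClone

variable {κ : Cardinal.{u}}

/-- A three-element index set in the universe `u`. -/
abbrev Three : Type u := ULift.{u} (Fin 3)

theorem mk_three_lt (hκ : ℵ₀ ≤ κ) : #Three.{u} < κ :=
  (lt_aleph0_of_finite Three.{u}).trans_le hκ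

/-- The triple `(x, y, z)` as a family indexed by `Three`. -/
def triple {α : Type*} (x y z : α) : Three.{u} → α := fun i => ![x, y, z] i.down

theorem triple_map {α β : Type*} (f : α → β) (x y z : α) (i : Three.{u}) :
    f (triple x y z i) = triple (f x) (f y) (f z) i := by
  obtain ⟨i⟩ := i
  fin_cases i <;> rfl

theorem triple_rel {α : Type*} {r : α → α → Prop} {x y z x' y' z' : α} (hx : r x x')
    (hy : r y y') (hz : r z z') (i : Three.{u}) : r (triple x y z i) (triple x' y' z' i) := by
  obtain ⟨i⟩ := i
  fin_cases i
  exacts [hx, hy, hz]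

variable {C : SingleSortedClone κ}

theorem comp_compS {S : Type u} {hS : #S < κ} {l m : CloneArity κ} (f : C.Op (ofSet S hS))
    (x : S → C.Op l) (g : l.Idx → C.Op m) :
    C.comp (compS f x) g = compS f (fun s => C.comp (x s) g) :=
  (C.assoc f _ g).symm

theorem compS_projS_apply {S : Type u} {hS : #S < κ} {m : CloneArity κ} (s : S)
    (x : S → C.Op m) : compS (C.projS hS s) x = x s :=
  comp_projS x s

theorem compS_comp₁ {hκ : ℵ₀ ≤ κ} {S : Type u} {hS : #S < κ} {m : CloneArity κ}
    (e : C.Op (one hκ)) (f : C.Op (ofSet S hS)) (x : S → C.Op m) :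
    compS (comp₁ e f) x = comp₁ e (compS f x) :=
  comp₁_comp e f _

theorem comp₁_idem {hκ : ℵ₀ ≤ κ} {e : C.Op (one hκ)} (he : IsIdempotent e) {m : CloneArity κ}
    (f : C.Op m) : comp₁ e (comp₁ e f) = comp₁ e f := by
  rw [← comp₁_comp₁, show comp₁ e e = e from he]

theorem compS_compS {S T : Type u} {hS : #S < κ} {hT : #T < κ} {m : CloneArity κ}
    (f : C.Op (ofSet S hS)) (x : S → C.Op (ofSet T hT)) (y : T → C.Op m) :
    compS (compS f x) y = compS f (fun s => compS (x s) y) :=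
  comp_compS f x _

/-! ### Mal'cev's theorem for clones -/

/-- `p` is a Mal'cev element: `p(x, x, y) = y` and `p(x, y, y) = x`. -/
def IsMalcev {hT : #Three.{u} < κ} (p : C.Op (ofSet Three.{u} hT)) : Prop :=
  ∀ {m : CloneArity κ} (x y : C.Op m),
    compS p (triple x x y) = y ∧ compS p (triple x y y) = x

variable (C) in
/-- The free `C`-algebra on `l` generators. -/
def freeAlgebra (l : CloneArity κ) : C.Algebra where
  carrier := C.Op l
  act f x := C.comp f x
  act_proj i x := C.outer_id i x
  act_comp f g x := (C.assoc f g x).symm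

/-- The kernel of the endomorphism of the free algebra on `l` generators given by `g`. -/
def substKernel {l : CloneArity κ} (g : l.Idx → C.Op l) : (C.freeAlgebra l).Con where
  r a b := C.comp a g = C.comp b g
  iseqv := ⟨fun _ => rfl, fun h => h.symm, fun h h' => h.trans h'⟩
  act_rel f a b h := by
    change C.comp (C.comp f a) g = C.comp (C.comp f b) g
    exact (C.assoc f a g).symm.trans ((congrArg (C.comp f) (funext h)).trans (C.assoc f b g))

/-- The action of an element whose arguments are indexed by a set `S`. -/
noncomputable def Algebra.actS (A : C.Algebra) {S : Type u} {hS : #S < κ}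
    (f : C.Op (ofSet S hS)) (a : S → A.carrier) : A.carrier :=
  A.act f (fun i => a (idx i))

theorem Algebra.actS_projS (A : C.Algebra) {S : Type u} {hS : #S < κ} (s : S)
    (a : S → A.carrier) : A.actS (C.projS hS s) a = a s := by
  simp [actS, projS, A.act_proj]

theorem Algebra.actS_compS (A : C.Algebra) {S T : Type u} {hS : #S < κ} {hT : #T < κ}
    (f : C.Op (ofSet S hS)) (x : S → C.Op (ofSet T hT)) (a : T → A.carrier) :
    A.actS (compS f x) a = A.actS f (fun s => A.actS (x s) a) :=
  A.act_comp f _ _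

theorem Algebra.Con.actS_rel {A : C.Algebra} (θ : A.Con) {S : Type u} {hS : #S < κ}
    (f : C.Op (ofSet S hS)) {a b : S → A.carrier} (h : ∀ s, θ.r (a s) (b s)) :
    θ.r (A.actS f a) (A.actS f b) :=
  θ.act_rel f _ _ fun i => h (idx i)

theorem IsMalcev.actS {hT : #Three.{u} < κ} {p : C.Op (ofSet Three.{u} hT)}
    (hp : IsMalcev p) (A : C.Algebra) (a b : A.carrier) :
    A.actS p (triple a a b) = b ∧ A.actS p (triple a b b) = a := by
  let π : Three.{u} → C.Op (ofSet Three.{u} hT) := C.projS hT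
  have h := hp (π ⟨0⟩) (π ⟨1⟩)
  have h₁ := congrArg (fun f => A.actS f (triple a b b)) h.1
  have h₂ := congrArg (fun f => A.actS f (triple a b b)) h.2
  simp only [A.actS_compS, triple_map (fun f => A.actS f (triple a b b)), π,
    A.actS_projS] at h₁ h₂
  exact ⟨h₁, h₂⟩

/-- If `a θ b η c`, then `p(a,b,c)` is the new midpoint: `a = p(a,b,b) η p(a,b,c) θ p(a,a,c) = c`.
-/
theorem IsMalcev.comp_le {hT : #Three.{u} < κ} {p : C.Op (ofSet Three.{u} hT)}
    (hp : IsMalcev p) {A : C.Algebra} (θ η : A.Con) {a c : A.carrier}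
    (h : Relation.Comp θ.r η.r a c) : Relation.Comp η.r θ.r a c := by
  obtain ⟨b, hab, hbc⟩ := h
  refine ⟨A.actS p (triple a b c), ?_, ?_⟩
  · have := η.actS_rel p (triple_rel (η.refl a) (η.refl b) hbc)
    rwa [(hp.actS A a b).2] at this
  · have := θ.actS_rel p (triple_rel (θ.refl a) (θ.symm hab) (θ.refl c))
    rwa [(hp.actS A a c).1] at this

/-- In the free algebra on `X, Y, Z`, let `θ` and `η` be the kernels of the substitutions `Y ↦ X`
and `Y ↦ Z`. Since `X θ Y η Z`, permutability gives `w` with `X η w θ Z`, which says `X = w(X,Z,Z)`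
and `w(X,X,Z) = Z`. -/
theorem exists_isMalcev_of_congruencePermutable (hκ : ℵ₀ ≤ κ)
    (h : CongruencePermutable C.variety) :
    ∃ p : C.Op (ofSet Three.{u} (mk_three_lt hκ)), IsMalcev p := by
  let π : Three.{u} → C.Op (ofSet Three.{u} (mk_three_lt hκ)) := C.projS (mk_three_lt hκ)
  let X := π ⟨0⟩
  let Y := π ⟨1⟩
  let Z := π ⟨2⟩
  let θ := substKernel (fun i => triple X X Z (idx i))
  let η := substKernel (fun i => triple X Z Z (idx i))
  have hθ : θ.r X Y :=
    show compS X (triple X X Z) = compS Y (triple X X Z) from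
      (compS_projS_apply ⟨0⟩ (triple X X Z)).trans
        (compS_projS_apply ⟨1⟩ (triple X X Z)).symm
  have hη : η.r Y Z :=
    show compS Y (triple X Z Z) = compS Z (triple X Z Z) from
      (compS_projS_apply ⟨1⟩ (triple X Z Z)).trans
        (compS_projS_apply ⟨2⟩ (triple X Z Z)).symm
  have hc : Relation.Comp η.r θ.r X Z := by
    rw [← h (C.freeAlgebra _) trivial θ η]
    exact ⟨Y, hθ, hη⟩
  obtain ⟨w, h₁, h₂⟩ : ∃ w : C.Op (ofSet Three.{u} (mk_three_lt hκ)),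
      compS X (triple X Z Z) = compS w (triple X Z Z) ∧
        compS w (triple X X Z) = compS Z (triple X X Z) := hc
  refine ⟨w, fun x y => ?_⟩
  -- Only `X` and `Z` survive in the two identities, so the value substituted for `Y` is immaterial.
  have k₁ := congrArg (fun f => compS f (triple x y y)) h₁
  have k₂ := congrArg (fun f => compS f (triple x y y)) h₂
  simp only [compS_compS, triple_map (fun f => compS f (triple x y y)), X, Z, π,
    compS_projS_apply] at k₁ k₂
  exact ⟨k₂, k₁.symm⟩

/-- Mal'cev's theorem for varieties of algebras of a `<κ`-ary clone. -/
theorem congruencePermutable_iff_exists_isMalcev (hκ : ℵ₀ ≤ κ) :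
    CongruencePermutable C.variety ↔
      ∃ p : C.Op (ofSet Three.{u} (mk_three_lt hκ)), IsMalcev p := by
  refine ⟨exists_isMalcev_of_congruencePermutable hκ, ?_⟩
  rintro ⟨p, hp⟩ A - θ η
  funext a c
  exact propext ⟨hp.comp_le θ η, hp.comp_le η θ⟩

/-! ### Mal'cev elements of a clone and of its retracts -/

section Retract

variable {hκ : ℵ₀ ≤ κ} {e : C.Op (one hκ)}

theorem retract_compS_mk (he : IsIdempotent e) {S : Type u} {hS : #S < κ} {m : CloneArity κ}
    (f : C.Op (ofSet S hS)) (hf : comp₁ e f = f) (x : S → C.Op m)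
    (hx : ∀ s, comp₁ e (x s) = x s) :
    compS (C := retract e he) (RetractOp.mk f hf) (fun s => RetractOp.mk (x s) (hx s)) =
      RetractOp.mk (compS f x) (RetractOp.e_comp hf _) :=
  RetractOp.comp_mk f hf (fun i => x (idx i)) fun i => hx (idx i)

theorem compS_eq_of_mk_eq {S : Type u} {hS : #S < κ} {m : CloneArity κ}
    {f g : C.Op (ofSet S hS)} {hf : comp₁ e f = f} {hg : comp₁ e g = g}
    (h : RetractOp.mk f hf = RetractOp.mk g hg) (x : S → C.Op m) :
    compS f (fun s => comp₁ e (x s)) = compS g (fun s => comp₁ e (x s)) := by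
  have := congrArg (fun k => compS k x) (RetractOp.exact h)
  simpa only [compS, ← C.assoc, eproj, comp₁_comp, C.outer_id] using this

theorem triple_mk {m : CloneArity κ} {x y z : C.Op m} (hx : comp₁ e x = x)
    (hy : comp₁ e y = y) (hz : comp₁ e z = z) :
    triple (RetractOp.mk x hx) (RetractOp.mk y hy) (RetractOp.mk z hz) =
      fun i : Three.{u} => RetractOp.mk (triple x y z i)
        (by obtain ⟨i⟩ := i; fin_cases i; exacts [hx, hy, hz]) := by
  funext i
  obtain ⟨i⟩ := i
  fin_cases i <;> rfl

theorem retract_compS_triple (he : IsIdempotent e) {hT : #Three.{u} < κ} {m : CloneArity κ}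
    (f : C.Op (ofSet Three.{u} hT)) (hf : comp₁ e f = f) {x y z : C.Op m} (hx : comp₁ e x = x)
    (hy : comp₁ e y = y) (hz : comp₁ e z = z) :
    compS (C := retract e he) (RetractOp.mk f hf)
        (triple (RetractOp.mk x hx) (RetractOp.mk y hy) (RetractOp.mk z hz)) =
      RetractOp.mk (compS f (triple x y z)) (RetractOp.e_comp hf _) :=
  (congrArg (compS (C := retract e he) (RetractOp.mk f hf)) (triple_mk hx hy hz)).trans
    (retract_compS_mk he f hf _ _)

/-- Representatives of elements of `e(C)` are fixed by `e`, so `e ∘ p(x,x,y) = e ∘ y = y`. -/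
theorem IsMalcev.retract {p : C.Op (ofSet Three.{u} (mk_three_lt hκ))} (hp : IsMalcev p)
    (he : IsIdempotent e) :
    ∃ q : (retract e he).Op (ofSet Three.{u} (mk_three_lt hκ)), IsMalcev q := by
  refine ⟨RetractOp.mk (comp₁ e p) (comp₁_idem he p), fun {m} x y => ?_⟩
  obtain ⟨x, hx, rfl⟩ : ∃ f hf, RetractOp.mk f hf = x := ⟨_, _, x.mk_rep⟩
  obtain ⟨y, hy, rfl⟩ : ∃ f hf, RetractOp.mk f hf = y := ⟨_, _, y.mk_rep⟩
  constructor
  · refine (retract_compS_triple he _ _ _ _ _).trans (RetractOp.sound ?_)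
    rw [compS_comp₁, (hp x y).1, hy]
  · refine (retract_compS_triple he _ _ _ _ _).trans (RetractOp.sound ?_)
    rw [compS_comp₁, (hp x y).2, hx]

/-- Equality in `e(C)` compares representatives only after substituting `e ∘ π_i`, so the identities
for `p` are recovered just on arguments of the form `e ∘ x`. They come from the generic instance `e
∘ π_0`, `e ∘ π_1`. -/
theorem IsMalcev.of_retract {he : IsIdempotent e}
    {q : (SingleSortedClone.retract e he).Op (ofSet Three.{u} (mk_three_lt hκ))}
    (hq : IsMalcev q) :
    ∃ p : C.Op (ofSet Three.{u} (mk_three_lt hκ)), ∀ {m : CloneArity κ} (x y : C.Op m),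
      compS p (triple (comp₁ e x) (comp₁ e x) (comp₁ e y)) = comp₁ e y ∧
        compS p (triple (comp₁ e x) (comp₁ e y) (comp₁ e y)) = comp₁ e x := by
  obtain ⟨p, hp, rfl⟩ : ∃ f hf, RetractOp.mk f hf = q := ⟨_, _, q.mk_rep⟩
  refine ⟨p, fun {m} x y => ?_⟩
  let π : Three.{u} → C.Op (ofSet Three.{u} (mk_three_lt hκ)) := C.projS (mk_three_lt hκ)
  have h := hq (RetractOp.mk (comp₁ e (π ⟨0⟩)) (comp₁_idem he _))
    (RetractOp.mk (comp₁ e (π ⟨1⟩)) (comp₁_idem he _))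
  have h₁ := compS_eq_of_mk_eq ((retract_compS_triple he _ _ _ _ _).symm.trans h.1) (triple x y y)
  have h₂ := compS_eq_of_mk_eq ((retract_compS_triple he _ _ _ _ _).symm.trans h.2) (triple x y y)
  simp only [compS_compS, triple_map (fun f => compS f fun s => comp₁ e (triple x y y s)),
    compS_comp₁, π, compS_projS_apply, comp₁_idem he] at h₁ h₂
  exact ⟨h₁, h₂⟩

end Retract

/-! ### Gluing along the diagonal pair -/

section DiagonalPair

variable {hκ : ℵ₀ ≤ κ} {S : Type u} {hS : #S < κ} {d : C.Op (ofSet S hS)} {e : S → C.Op (one hκ)}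

/-- By `d_e` the inner `e_s` may be dropped, and `d` is idempotent by `d_diag`. The index `s₀`
supplies the projection into which `x` is substituted. -/
theorem IsDiagonalPair.compS_comp₁_const (h : IsDiagonalPair d e) (s₀ : S) {m : CloneArity κ}
    (x : C.Op m) : compS d (fun s => comp₁ (e s) x) = x := by
  have h₁ := congrArg (fun f => compS f (fun _ => x)) h.d_e
  have h₂ := congrArg (fun f => compS f (fun _ => x)) (h.d_diag s₀)
  simp only [compS_compS, compS_comp₁, compS_projS_apply] at h₁ h₂
  exact h₁.trans h₂

theorem IsDiagonalPair.exists_isMalcev (h : IsDiagonalPair d e) (s₀ : S)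
    (p : S → C.Op (ofSet Three.{u} (mk_three_lt hκ)))
    (hp : ∀ s {m : CloneArity κ} (x y : C.Op m),
      compS (p s) (triple (comp₁ (e s) x) (comp₁ (e s) x) (comp₁ (e s) y)) = comp₁ (e s) y ∧
        compS (p s) (triple (comp₁ (e s) x) (comp₁ (e s) y) (comp₁ (e s) y)) = comp₁ (e s) x) :
    ∃ q : C.Op (ofSet Three.{u} (mk_three_lt hκ)), IsMalcev q := by
  -- The inner `e_s` move all arguments to where `p_s` satisfies the Mal'cev identities.
  refine ⟨compS d fun s => compS (p s) fun i => comp₁ (e s) (C.projS (mk_three_lt hκ) i),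
    fun x y => ?_⟩
  simp only [compS_compS, compS_comp₁, compS_projS_apply]
  constructor
  · refine Eq.trans ?_ (h.compS_comp₁_const s₀ y)
    congr 1
    funext s
    rw [← (hp s x y).1, funext (triple_map (comp₁ (e s)) x x y)]
  · refine Eq.trans ?_ (h.compS_comp₁_const s₀ x)
    congr 1
    funext s
    rw [← (hp s x y).2, funext (triple_map (comp₁ (e s)) x y y)]

end DiagonalPair

end SingleSortedClone

theorem mainTheorem9 {κ : Cardinal.{u}} (hκ : ℵ₀ ≤ κ) {S : Type u} [Nonempty S] (hS : #S < κ)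
    (C : SingleSortedClone κ) (d : C.Op (SingleSortedClone.ofSet S hS)) (e : S → C.Op (SingleSortedClone.one hκ))
    (h : SingleSortedClone.IsDiagonalPair d e) :
    SingleSortedClone.CongruencePermutable C.variety ↔
      ∀ s : S, SingleSortedClone.CongruencePermutable
        (SingleSortedClone.retract (e s) (h.idempotent s)).variety := by
  simp only [SingleSortedClone.congruencePermutable_iff_exists_isMalcev hκ]
  constructor
  · rintro ⟨p, hp⟩ s
    exact hp.retract (h.idempotent s)
  · intro hq
    obtain ⟨s₀⟩ := ‹Nonempty S›
    choose p hp using fun s =>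
      SingleSortedClone.IsMalcev.of_retract (hq s).choose_spec
    exact h.exists_isMalcev s₀ p hp
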